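/- **Theorem.** Let $Fm$ be the set of formulas built from a countably infinite set $Prop$ of propositional variables in the language of H\'ajek's Basic Logic (constant $\bar 0$, strong conjunction $*$, implication $\to$) expanded with two unary connectives $\square$ and $\lozenge$. Abbreviate $\neg\varphi := \varphi\to\bar 0$, $\bar 1 := \bar 0\to\bar 0$, $\varphi\wedge\psi := \varphi*(\varphi\to\psi)$, $\varphi\vee\psi := ((\varphi\to\psi)\to\psi)\wedge((\psi\to\varphi)\to\varphi)$, $\varphi\equiv\psi := (\varphi\to\psi)\wedge(\psi\to\varphi)$, and let $\varphi^n$ be the strong conjunction of $n$ copies of $\varphi$ ($\varphi^0 := \bar 1$). *The calculus $\mathrm{S5}(\mathcal L)_\infty$.* The axioms are all instances of the following schemata, where $\varphi,\psi,\chi$ are arbitrary formulas and $\nu$ is any propositional combination of formulas beginning with $\square$ or $\lozenge$: - (axioms of infinite-valued \L ukasiewicz logic $\mathcal L$) $(\varphi\to\psi)\to((\psi\to\chi)\to(\varphi\to\chi))$; $\ (\varphi*\psi)\to\varphi$; $\ (\varphi*\psi)\to(\psi*\varphi)$; $\ (\varphi*(\varphi\to\psi))\to(\psi*(\psi\to\varphi))$;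 $\ (\varphi\to(\psi\to\chi))\to((\varphi*\psi)\to\chi)$; $\ ((\varphi*\psi)\to\chi)\to(\varphi\to(\psi\to\chi))$; $\ ((\varphi\to\psi)\to\chi)\to(((\psi\to\varphi)\to\chi)\to\chi)$; $\ \bar 0\to\varphi$; $\ \neg\neg\varphi\to\varphi$; - $\square\varphi\to\varphi$; $\ \varphi\to\lozenge\varphi$; $\ \square(\nu\to\varphi)\to(\nu\to\square\varphi)$; $\ \square(\varphi\to\nu)\to(\lozenge\varphi\to\nu)$; $\ \square(\varphi\vee\nu)\to(\square\varphi\vee\nu)$; $\ \lozenge(\varphi*\varphi)\equiv(\lozenge\varphi)*(\lozenge\varphi)$. The rules are Modus Ponens (from $\varphi$ and $\varphi\to\psi$ infer $\psi$), Necessitation (from $\varphi$ infer $\square\varphi$), and the infinitary rule $\square\mathrm{Inf}$: from the premises $\square\varphi\vee(\square\alpha\to(\square\beta)^n)$, one for each $n\in\mathbb N$, infer $\square\varphi\vee(\square\alpha\to\square\alpha*\square\beta)$. For $\Gamma\cup\{\varphi\}\subseteq Fm$ write $\Gamma\vdash\varphi$ if there are an ordinal $\xi$ and a family of formulas $\{\psi_i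 : i\le\xi\}$ such that $\psi_\xi=\varphi$ and, for each $i\le\xi$, the formula $\psi_i$ belongs to $\Gamma$, or is an instance of an axiom, or is the lower formula of an instance of a rule all of whose upper formulas lie in $\{\psi_j : j<i\}$. *The logic $\mathrm{S5}([0,1]_{\text{\L}})$.* On $[0,1]$ put $a*b := \max(0,a+b-1)$ and $a\to b := \min(1,1-a+b)$. A structure is a pair $\mathbf K=\langle X,e\rangle$ with $X$ a non-empty set and $e\colon X\times Prop\to[0,1]$ a function. The truth value $\|\varphi\|_{\mathbf K,x}\in[0,1]$ of a formula at $x\in X$ is defined by recursion: $\|p\|_{\mathbf K,x}=e(x,p)$, $\|\bar 0\|_{\mathbf K,x}=0$, the connectives $*$ and $\to$ are evaluated pointwise by the operations above, $\|\square\psi\|_{\mathbf K,x}=\inf_{x'\in X}\|\psi\|_{\mathbf K,x'}$ and $\|\lozenge\psi\|_{\mathbf K,x}=\sup_{x'\in X}\|\psi\|_{\mathbf K,x'}$. $\mathbf K$ is a model of $\Gamma$ if $\|\gamma\|_{\mathbf K,x}=1$ for all $\gamma\in\Gamma$ and $x\in X$. Write $\Gamma\vDash_{\mathrm{S5}([0,1]_{\text{\L}})}\varphi$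 if every model of $\Gamma$ is a model of $\varphi$. Then for every set of formulas $\Gamma\cup\{\varphi\}\subseteq Fm$, $$\Gamma\vdash\varphi \quad\text{if and only if}\quad \Gamma\vDash_{\mathrm{S5}([0,1]_{\text{\L}})}\varphi .$$ -/

import Mathlib

universe u

namespace S5Luk

/-- Formulas over the countably infinite set `ℕ` of propositional variables, in the language of
Basic Logic (`0̄`, strong conjunction `*`, implication `→`) expanded with `□` and `◇`. -/
inductive Formula : Type
  | var : ℕ → Formula
  | zero : Formula
  | conj : Formula → Formula → Formula
  | imp : Formula → Formula → Formula
  | box : Formula → Formula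
  | dia : Formula → Formula

namespace Formula

/-- `¬ φ := φ → 0̄`. -/
def neg (φ : Formula) : Formula := imp φ zero

/-- `1̄ := 0̄ → 0̄`. -/
def one : Formula := imp zero zero

/-- `φ ∧ ψ := φ * (φ → ψ)`. -/
def and (φ ψ : Formula) : Formula := conj φ (imp φ ψ)

/-- `φ ∨ ψ := ((φ → ψ) → ψ) ∧ ((ψ → φ) → φ)`. -/
def or (φ ψ : Formula) : Formula := and (imp (imp φ ψ) ψ) (imp (imp ψ φ) φ)

/-- `φ ≡ ψ := (φ → ψ) ∧ (ψ → φ)`. -/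
def equiv (φ ψ : Formula) : Formula := and (imp φ ψ) (imp ψ φ)

/-- `φ ^ n = φ * ⋯ * φ` (`n` factors), with `φ ^ 0 = 1̄` and `φ ^ 1 = φ`. -/
def pow (φ : Formula) : ℕ → Formula
  | 0 => one
  | 1 => φ
  | n + 2 => conj (pow φ (n + 1)) φ

/-- The propositional combinations of formulas beginning with `□` or `◇`. -/
inductive IsModalCombination : Formula → Prop
  | box (φ : Formula) : IsModalCombination (box φ)
  | dia (φ : Formula) : IsModalCombination (dia φ)
  | zero : IsModalCombination zero
  | conj {φ ψ : Formula} (hφ : IsModalCombination φ) (hψ : IsModalCombination ψ) :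
      IsModalCombination (conj φ ψ)
  | imp {φ ψ : Formula} (hφ : IsModalCombination φ) (hψ : IsModalCombination ψ) :
      IsModalCombination (imp φ ψ)

end Formula

open Formula

/-- Instances of the axiom schemata of infinite-valued Łukasiewicz logic: Hájek's axioms of Basic
Logic together with double negation elimination. -/
inductive LukAxiom : Formula → Prop
  | trans (φ ψ χ : Formula) : LukAxiom (imp (imp φ ψ) (imp (imp ψ χ) (imp φ χ)))
  | conj_left (φ ψ : Formula) : LukAxiom (imp (conj φ ψ) φ)
  | conj_comm (φ ψ : Formula) : LukAxiom (imp (conj φ ψ) (conj ψ φ))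
  | div (φ ψ : Formula) : LukAxiom (imp (conj φ (imp φ ψ)) (conj ψ (imp ψ φ)))
  | import_ (φ ψ χ : Formula) : LukAxiom (imp (imp φ (imp ψ χ)) (imp (conj φ ψ) χ))
  | export_ (φ ψ χ : Formula) : LukAxiom (imp (imp (conj φ ψ) χ) (imp φ (imp ψ χ)))
  | prelin (φ ψ χ : Formula) :
      LukAxiom (imp (imp (imp φ ψ) χ) (imp (imp (imp ψ φ) χ) χ))
  | exFalso (φ : Formula) : LukAxiom (imp zero φ)
  | dne (φ : Formula) : LukAxiom (imp (neg (neg φ)) φ)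

/-- Instances of the axioms of the calculus `S5(Ł)`. -/
inductive S5Axiom : Formula → Prop
  | luk {φ : Formula} (h : LukAxiom φ) : S5Axiom φ
  | box_elim (φ : Formula) : S5Axiom (imp (box φ) φ)
  | dia_intro (φ : Formula) : S5Axiom (imp φ (dia φ))
  | box_imp {ν : Formula} (φ : Formula) (hν : IsModalCombination ν) :
      S5Axiom (imp (box (imp ν φ)) (imp ν (box φ)))
  | dia_imp {ν : Formula} (φ : Formula) (hν : IsModalCombination ν) :
      S5Axiom (imp (box (imp φ ν)) (imp (dia φ) ν))
  | box_or {ν : Formula} (φ : Formula) (hν : IsModalCombination ν) :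
      S5Axiom (imp (box (or φ ν)) (or (box φ) ν))
  | dia_conj (φ : Formula) : S5Axiom (equiv (dia (conj φ φ)) (conj (dia φ) (dia φ)))

/-- Instances of the inference rules of `S5(Ł)_∞`: `S5Rule P φ` says that some instance of a rule
has the set `P` of upper formulas and the lower formula `φ`. -/
inductive S5Rule : Set Formula → Formula → Prop
  /-- Modus Ponens. -/
  | mp (φ ψ : Formula) : S5Rule {φ, imp φ ψ} ψ
  /-- Necessitation. -/
  | nec (φ : Formula) : S5Rule {φ} (box φ)
  /-- The infinitary rule `□Inf`. -/
  | boxInf (φ α β : Formula) :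
      S5Rule (Set.range fun n : ℕ => or (box φ) (imp (box α) (pow (box β) n)))
        (or (box φ) (imp (box α) (conj (box α) (box β))))

/-- The family `(ψ i)`, `i ≤ ξ`, is a proof from `Γ` of length `ξ`: every member belongs to `Γ`, is
an instance of an axiom, or follows by a rule from members with smaller index. (The values of `ψ`
beyond `ξ` are irrelevant.) -/
def IsProof (Γ : Set Formula) (ξ : Ordinal.{0}) (ψ : Ordinal.{0} → Formula) : Prop :=
  ∀ i ≤ ξ, ψ i ∈ Γ ∨ S5Axiom (ψ i) ∨ ∃ P : Set Formula, P ⊆ ψ '' Set.Iio i ∧ S5Rule P (ψ i)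

/-- `Γ ⊢ φ` in `S5(Ł)_∞`: there is a proof from `Γ`, possibly of transfinite length, that ends
with `φ`. -/
def Provable (Γ : Set Formula) (φ : Formula) : Prop :=
  ∃ (ξ : Ordinal.{0}) (ψ : Ordinal.{0} → Formula), IsProof Γ ξ ψ ∧ ψ ξ = φ

/-- The Łukasiewicz t-norm `a * b = max (0, a + b - 1)` on `[0,1]`. -/
noncomputable def lukConj (a b : unitInterval) : unitInterval :=
  ⟨max 0 ((a : ℝ) + b - 1), le_max_left _ _,
    max_le zero_le_one (by linarith [a.2.2, b.2.2])⟩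

/-- The residuum `a → b = min (1, 1 - a + b)` of the Łukasiewicz t-norm. -/
noncomputable def lukImp (a b : unitInterval) : unitInterval :=
  ⟨min 1 (1 - (a : ℝ) + b), le_min zero_le_one (by linarith [a.2.2, b.2.1]),
    min_le_left _ _⟩

/-- Structures `⟨X, e, [0,1]_Ł⟩` with `X` non-empty. All of them are safe, as the lattice `[0,1]`
is complete. -/
structure StdStructure : Type (u + 1) where
  X : Type u
  nonempty : Nonempty X
  e : X → ℕ → unitInterval

namespace StdStructure

/-- The truth value of a formula at a point. -/
noncomputable def truth (K : StdStructure.{u}) : Formula → K.X → unitInterval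
  | var p, x => K.e x p
  | zero, _ => 0
  | conj φ ψ, x => lukConj (K.truth φ x) (K.truth ψ x)
  | imp φ ψ, x => lukImp (K.truth φ x) (K.truth ψ x)
  | box φ, _ => ⨅ x' : K.X, K.truth φ x'
  | dia φ, _ => ⨆ x' : K.X, K.truth φ x'

/-- `K` is a model of `Γ`. -/
def IsModel (K : StdStructure.{u}) (Γ : Set Formula) : Prop :=
  ∀ φ ∈ Γ, ∀ x : K.X, K.truth φ x = 1

end StdStructure

/-- `Γ ⊨ φ` in `S5([0,1]_Ł)`: every model of `Γ` is a model of `φ`. -/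
def Entails (Γ : Set Formula) (φ : Formula) : Prop :=
  ∀ K : StdStructure.{u}, K.IsModel Γ → K.IsModel {φ}

end S5Luk

namespace S5Luk

/-! Soundness is a pointwise computation. The rule `□Inf` is sound because `[0,1]` is archimedean:
if `c ≤ x ^ n` for all `n`, then `x = 1` or `c = 0`.

For completeness, let `a` be underivable from `Γ`. The rule `□Inf` shows that if `a` follows from
`□b`, and also from `¬(□b)^n` for every `n`, then `a` is derivable outright (`Der.of_insert_box`).
Enumerating the formulas, one extends `Γ` to a theory `T` that omits `a`, is closed under Modus
Ponens and Necessitation, and contains `□b` or some `¬(□b)^n` for each `b`. Closure of `T` under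
`□Inf` is not needed.

The canonical points are all propositional valuations in `[0,1]` that make `T` true. Two points
agree on modal combinations: otherwise some modal combination `b` has value `1` at one of them only,
and neither alternative for `□b` is possible. The core is that `◇a` is the supremum of the values of
`a` (`val_dia_le`). If the values stayed below `◇a` by a fixed gap, the formula `c := ◇a → a` would
stay away from `1`, so some power `c^(2^n)` would vanish at all points; yet `◇c`, and by the axiom
on `◇(φ * φ)` also `◇(c^(2^n))`, has value `1`.

Points come from a weak form of propositional completeness. A theory omitting a formula extends to a
linear one, whose Lindenbaum algebra is an MV-chain. The chain may contain infinitesimals, and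
`LukChain.size` maps it to `[0,1]` by a standard part. Only non-strict inequalities survive this
map, hence the bound `1/2` in `exists_valuation_of_notMem`. -/

open Formula Filter Topology

/-! ### Propositional Łukasiewicz calculus inside a theory -/

/-- A set of formulas containing the axioms of Łukasiewicz logic and closed under Modus Ponens. -/
structure IsTheory (S : Set Formula) : Prop where
  luk : ∀ {φ}, LukAxiom φ → φ ∈ S
  mp : ∀ {φ ψ}, φ ∈ S → imp φ ψ ∈ S → ψ ∈ S

namespace IsTheory

variable {S : Set Formula} {a b c d : Formula}

theorem trans (h : IsTheory S) (hab : imp a b ∈ S) (hbc : imp b c ∈ S) : imp a c ∈ S :=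
  h.mp hbc (h.mp hab (h.luk (.trans a b c)))

theorem conj_left (h : IsTheory S) (a b : Formula) : imp (conj a b) a ∈ S :=
  h.luk (.conj_left a b)

theorem conj_comm (h : IsTheory S) (a b : Formula) : imp (conj a b) (conj b a) ∈ S :=
  h.luk (.conj_comm a b)

theorem conj_right (h : IsTheory S) (a b : Formula) : imp (conj a b) b ∈ S :=
  h.trans (h.conj_comm a b) (h.conj_left b a)

theorem imp_conj_iff (h : IsTheory S) : imp (conj a b) c ∈ S ↔ imp a (imp b c) ∈ S :=
  ⟨fun hc => h.mp hc (h.luk (.export_ a b c)), fun hc => h.mp hc (h.luk (.import_ a b c))⟩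

theorem weaken (h : IsTheory S) (ha : a ∈ S) (b : Formula) : imp b a ∈ S :=
  h.mp ha (h.imp_conj_iff.1 (h.conj_left a b))

theorem refl (h : IsTheory S) (a : Formula) : imp a a ∈ S :=
  h.mp (h.luk (.exFalso zero)) (h.imp_conj_iff.1 (h.conj_right _ a))

theorem imp_elim (h : IsTheory S) (a b : Formula) : imp (conj (imp a b) a) b ∈ S :=
  h.imp_conj_iff.2 (h.refl _)

theorem imp_elim' (h : IsTheory S) (a b : Formula) : imp (conj a (imp a b)) b ∈ S :=
  h.trans (h.conj_comm _ _) (h.imp_elim a b)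

theorem conj_mono_left (h : IsTheory S) (hab : imp a b ∈ S) (c : Formula) :
    imp (conj a c) (conj b c) ∈ S :=
  h.imp_conj_iff.2 (h.trans hab (h.imp_conj_iff.1 (h.refl _)))

theorem conj_mono_right (h : IsTheory S) (c : Formula) (hab : imp a b ∈ S) :
    imp (conj c a) (conj c b) ∈ S :=
  h.trans (h.conj_comm _ _) (h.trans (h.conj_mono_left hab c) (h.conj_comm _ _))

theorem conj_mono (h : IsTheory S) (hab : imp a b ∈ S) (hcd : imp c d ∈ S) :
    imp (conj a c) (conj b d) ∈ S :=
  h.trans (h.conj_mono_left hab c) (h.conj_mono_right b hcd)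

theorem conj_mem (h : IsTheory S) (ha : a ∈ S) (hb : b ∈ S) : conj a b ∈ S :=
  h.mp hb (h.mp ha (h.imp_conj_iff.1 (h.refl _)))

theorem imp_mono (h : IsTheory S) (hba : imp b a ∈ S) (hcd : imp c d ∈ S) :
    imp (imp a c) (imp b d) ∈ S :=
  h.imp_conj_iff.1 (h.trans (h.conj_mono_right _ hba) (h.trans (h.imp_elim a c) hcd))

theorem conj_assoc (h : IsTheory S) (a b c : Formula) :
    imp (conj (conj a b) c) (conj a (conj b c)) ∈ S :=
  h.imp_conj_iff.2 (h.imp_conj_iff.2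
    (h.trans (h.imp_conj_iff.1 (h.refl _)) (h.luk (.export_ b c _))))

theorem conj_assoc' (h : IsTheory S) (a b c : Formula) :
    imp (conj a (conj b c)) (conj (conj a b) c) ∈ S :=
  h.imp_conj_iff.2 (h.trans (h.imp_conj_iff.1 (h.imp_conj_iff.1 (h.refl _)))
    (h.luk (.import_ b c _)))

theorem imp_and (h : IsTheory S) (hab : imp a b ∈ S) (hac : imp a c ∈ S) :
    imp a (and b c) ∈ S := by
  have h1 : imp a (conj a (imp a b)) ∈ S :=
    h.trans (h.mp hab (h.imp_conj_iff.1 (h.refl _))) (h.conj_comm _ _)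
  exact h.trans h1 (h.trans (h.luk (.div a b)) (h.conj_mono_right _ (h.imp_mono (h.refl _) hac)))

theorem or_left (h : IsTheory S) (a b : Formula) : imp a (or a b) ∈ S :=
  h.imp_and (h.imp_conj_iff.1 (h.imp_elim' _ _)) (h.imp_conj_iff.1 (h.conj_left _ _))

theorem or_right (h : IsTheory S) (a b : Formula) : imp b (or a b) ∈ S :=
  h.imp_and (h.imp_conj_iff.1 (h.conj_left _ _)) (h.imp_conj_iff.1 (h.imp_elim' _ _))

/-- By prelinearity it is enough to derive the conclusion from `a → b` and from `b → a`; each of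
these collapses `a ∨ b` to one disjunct. -/
theorem conj_or_imp (h : IsTheory S) (hac : imp (conj d a) c ∈ S) (hbc : imp (conj d b) c ∈ S) :
    imp (conj d (or a b)) c ∈ S := by
  have key {x y : Formula} (hy : imp (conj d y) c ∈ S)
      (hxy : imp (or a b) (imp (imp x y) y) ∈ S) :
      imp (imp x y) (imp (conj d (or a b)) c) ∈ S := by
    refine h.imp_conj_iff.1 (h.trans (h.conj_comm _ _) (h.trans (h.conj_assoc _ _ _)
      (h.trans (h.conj_mono_right _ ?_) hy)))
    exact h.imp_conj_iff.2 hxy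
  have h1 := key (x := a) hbc (h.conj_left _ _)
  have h2 := key (x := b) hac (h.trans (h.luk (.div _ _)) (h.conj_left _ _))
  exact h.mp h2 (h.mp h1 (h.luk (.prelin a b _)))

theorem or_imp (h : IsTheory S) (hac : imp a c ∈ S) (hbc : imp b c ∈ S) : imp (or a b) c ∈ S := by
  have h1 := h.conj_or_imp (d := imp zero zero) (h.trans (h.conj_right _ _) hac)
    (h.trans (h.conj_right _ _) hbc)
  exact h.mp (h.refl zero) (h.imp_conj_iff.1 h1)

theorem or_elim (h : IsTheory S) (hab : or a b ∈ S) (hac : imp a c ∈ S) (hbc : imp b c ∈ S) :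
    c ∈ S :=
  h.mp hab (h.or_imp hac hbc)

theorem or_mono_left (h : IsTheory S) (hac : imp a c ∈ S) (hab : or a b ∈ S) : or c b ∈ S :=
  h.or_elim hab (h.trans hac (h.or_left _ _)) (h.or_right _ _)

theorem or_mono_right (h : IsTheory S) (hbc : imp b c ∈ S) (hab : or a b ∈ S) : or a c ∈ S :=
  h.or_elim hab (h.or_left _ _) (h.trans hbc (h.or_right _ _))

theorem or_symm (h : IsTheory S) (hab : or a b ∈ S) : or b a ∈ S :=
  h.or_elim hab (h.or_right _ _) (h.or_left _ _)

theorem imp_or_imp (h : IsTheory S) (a b : Formula) : or (imp a b) (imp b a) ∈ S :=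
  h.mp (h.or_right _ _) (h.mp (h.or_left _ _) (h.luk (.prelin a b _)))

/-- On distributing `(a ∨ c) * (b ∨ c)`, every term other than `a * b` lies below `c`. This carries
Modus Ponens through a side disjunct without contraction. -/
theorem or_conj (h : IsTheory S) (hac : or a c ∈ S) (hbc : or b c ∈ S) :
    or (conj a b) c ∈ S := by
  refine h.mp (h.conj_mem hac hbc) (h.conj_or_imp (h.trans (h.conj_comm _ _) ?_)
    (h.trans (h.conj_right _ _) (h.or_right _ _)))
  exact h.conj_or_imp (h.trans (h.conj_comm _ _) (h.or_left _ _))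
    (h.trans (h.conj_right _ _) (h.or_right _ _))

theorem neg_neg_imp (h : IsTheory S) (a : Formula) : imp (neg (neg a)) a ∈ S := h.luk (.dne a)

theorem imp_neg_neg (h : IsTheory S) (a : Formula) : imp a (neg (neg a)) ∈ S :=
  h.imp_conj_iff.1 (h.imp_elim' _ _)

theorem neg_mono (h : IsTheory S) (hab : imp a b ∈ S) : imp (neg b) (neg a) ∈ S :=
  h.imp_mono hab (h.refl _)

theorem imp_neg_conj_neg (h : IsTheory S) (a b : Formula) :
    imp (imp a b) (neg (conj a (neg b))) ∈ S :=
  h.imp_conj_iff.1 (h.trans (h.conj_assoc' _ _ _)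
    (h.trans (h.conj_mono_left (h.imp_elim a b) _) (h.imp_elim' b zero)))

theorem neg_conj_neg_imp (h : IsTheory S) (a b : Formula) :
    imp (neg (conj a (neg b))) (imp a b) ∈ S :=
  h.trans (h.luk (.export_ a (neg b) zero)) (h.imp_mono (h.refl _) (h.neg_neg_imp b))

end IsTheory

/-! ### MV-chains and their standard part -/

/-- Linearly ordered MV-algebras, in terms of the strong conjunction `*` and the negation `-`. -/
class LukChain (C : Type u) extends LinearOrder C, CommMonoid C, InvolutiveNeg C where
  le_one' : ∀ a : C, a ≤ 1
  mul_le_iff : ∀ a b c : C, a * b ≤ c ↔ a ≤ -(b * -c)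
  mul_residuum : ∀ a b : C, a * -(a * -b) = min a b
  neg_one_ne_one : (-1 : C) ≠ 1

namespace LukChain

variable {C : Type u} [LukChain C] {a b c : C}

theorem mul_le_neg_one : a * b ≤ -1 ↔ a ≤ -b := by
  rw [mul_le_iff, neg_neg, mul_one]

theorem le_neg_comm : a ≤ -b ↔ b ≤ -a := by
  rw [← mul_le_neg_one, mul_comm, mul_le_neg_one]

theorem neg_le_comm : -a ≤ b ↔ -b ≤ a := by
  have := le_neg_comm (a := -a) (b := -b)
  simpa using this

theorem neg_le_neg_of_le (h : a ≤ b) : -b ≤ -a :=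
  le_neg_comm.1 (by simpa using h)

theorem neg_one_le (a : C) : -1 ≤ a := neg_le_comm.1 (le_one' _)

theorem mul_mono_left (h : a ≤ b) (c : C) : a * c ≤ b * c :=
  (mul_le_iff _ _ _).2 (h.trans ((mul_le_iff _ _ _).1 le_rfl))

theorem mul_eq_neg_one (h : a ≤ -b) : a * b = -1 :=
  le_antisymm (mul_le_neg_one.2 h) (neg_one_le _)

theorem mul_le_left (a b : C) : a * b ≤ a := by
  have := mul_mono_left (le_one' b) a
  rwa [one_mul, mul_comm] at this

/-- The strong disjunction. -/
def sadd (a b : C) : C := -(-a * -b)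

theorem sadd_comm (a b : C) : sadd a b = sadd b a := by
  rw [sadd, mul_comm, sadd]

theorem sadd_assoc (a b c : C) : sadd (sadd a b) c = sadd a (sadd b c) := by
  simp only [sadd, neg_neg, mul_assoc]

theorem le_sadd_right (a b : C) : b ≤ sadd a b := by
  rw [sadd, le_neg_comm, mul_comm]; exact mul_le_left _ _

theorem neg_le_sadd_iff : -sadd a b ≤ c ↔ -a ≤ sadd b c := by
  rw [sadd, sadd, neg_neg, mul_le_iff]

theorem sadd_mul_neg (h : a ≤ -b) : sadd a b * -b = a := by
  have := mul_residuum (-b) a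
  rw [min_eq_right h] at this
  rw [sadd, mul_comm, mul_comm (-a), this]

theorem neg_mul_mul (h : -b ≤ a) : -(a * b) * b = -a := by
  have := sadd_mul_neg (a := -a) (b := -b) (by rw [neg_neg]; exact neg_le_comm.1 h)
  rwa [sadd, neg_neg, neg_neg] at this

theorem mul_sadd_neg (h : -b ≤ a) : sadd (a * b) (-b) = a := by
  rw [sadd, neg_neg, neg_mul_mul h, neg_neg]

theorem sadd_eq_one_iff : sadd a b = 1 ↔ -a ≤ b := by
  rw [sadd, neg_eq_iff_eq_neg, ← (neg_one_le _).ge_iff_eq', mul_le_neg_one, neg_neg]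

/-- Both sides are `a + b + c - 1`; the hypotheses say that `a + b` and `b + c` do not exceed `1`.
The next two lemmas treat the other carry patterns. -/
theorem sadd_mul_eq_mul_sadd (h₁ : a ≤ -b) (h₂ : b ≤ -c) : sadd a b * c = a * sadd b c := by
  have hc : sadd b c * -b = c := by
    rw [sadd_comm]; exact sadd_mul_neg (le_neg_comm.1 h₂)
  calc sadd a b * c = sadd a b * -b * sadd b c := by rw [mul_assoc, mul_comm (-b), hc]
    _ = a * sadd b c := by rw [sadd_mul_neg h₁]

theorem mul_sadd_eq_sadd_mul (h₁ : -b ≤ a) (h₂ : -c ≤ b) : sadd (a * b) c = sadd a (b * c) := by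
  have := sadd_mul_eq_mul_sadd (a := -a) (b := -b) (c := -c)
    (by simpa using neg_le_comm.1 h₁) (by simpa using neg_le_comm.1 h₂)
  simp only [sadd, neg_neg] at this ⊢
  rw [this]

theorem sadd_mul_eq_sadd_mul (h₁ : a ≤ -b) (h₂ : -c ≤ b) : sadd a b * c = sadd a (b * c) := by
  have hb : sadd (b * c) (-c) = b := mul_sadd_neg h₂
  have hle : sadd a (b * c) ≤ c := by
    rw [sadd, neg_le_comm, ← neg_mul_mul (neg_le_comm.1 h₂), mul_comm c b, mul_comm]
    exact mul_mono_left (le_neg_comm.1 h₁) _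
  have := sadd_mul_neg (a := sadd a (b * c)) (b := -c) (by simpa using hle)
  rw [sadd_assoc, hb, neg_neg] at this
  exact this

/-- Addition with carry of elements of `ℕ × C`, read as an integral part and a remainder. -/
def carryAdd (x y : ℕ × C) : ℕ × C :=
  -- The condition says that the remainders add up to at least `1`; their product is then the excess
  -- over `1`. The pairs `(0, 1)` and `(1, -1)` stand for the same number but are kept distinct.
  if -x.2 ≤ y.2 then (x.1 + y.1 + 1, x.2 * y.2) else (x.1 + y.1, sadd x.2 y.2)

theorem carryAdd_comm (x y : ℕ × C) : carryAdd x y = carryAdd y x := by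
  have : -x.2 ≤ y.2 ↔ -y.2 ≤ x.2 := neg_le_comm
  simp only [carryAdd, this, mul_comm x.2, sadd_comm x.2, add_comm x.1]

theorem carryAdd_assoc (x y z : ℕ × C) :
    carryAdd (carryAdd x y) z = carryAdd x (carryAdd y z) := by
  obtain ⟨k, a⟩ := x
  obtain ⟨l, b⟩ := y
  obtain ⟨m, c⟩ := z
  by_cases h₁ : -a ≤ b <;> by_cases h₂ : -b ≤ c
  · have h : -(a * b) ≤ c ↔ -a ≤ b * c := by
      rw [← sadd_eq_one_iff, ← sadd_eq_one_iff,
        mul_sadd_eq_sadd_mul (neg_le_comm.1 h₁) (neg_le_comm.1 h₂)]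
    by_cases h₃ : -a ≤ b * c
    · simp [carryAdd, h₁, h₂, h₃, h, mul_assoc]; omega
    · simp only [carryAdd, h₁, h₂, h₃, h, if_true, if_false, Prod.mk.injEq]
      exact ⟨by omega, mul_sadd_eq_sadd_mul (neg_le_comm.1 h₁) (neg_le_comm.1 h₂)⟩
  · have h₃ : -a ≤ sadd b c := by
      rw [sadd_comm]; exact h₁.trans (le_sadd_right _ _)
    have h₄ : ¬ -(a * b) ≤ c := fun hc => h₂ (by
      refine le_trans (neg_le_neg_of_le ?_) hc
      rw [mul_comm]; exact mul_le_left _ _)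
    simp only [carryAdd, h₁, h₂, h₃, h₄, if_true, if_false, Prod.mk.injEq]
    refine ⟨by omega, ?_⟩
    rw [sadd_comm, mul_comm a, mul_comm a, sadd_comm b]
    exact (sadd_mul_eq_sadd_mul (not_le.1 h₂).le h₁).symm
  · have h₃ : -sadd a b ≤ c := 
      (neg_le_neg_of_le (le_sadd_right _ _)).trans h₂
    have h₄ : ¬ -a ≤ b * c := fun hc => h₁ (hc.trans (mul_le_left _ _))
    simp only [carryAdd, h₁, h₂, h₃, h₄, if_true, if_false, Prod.mk.injEq]
    exact ⟨by omega, sadd_mul_eq_sadd_mul (le_neg_comm.1 (not_le.1 h₁).le) (neg_le_comm.1 h₂)⟩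
  · have h := neg_le_sadd_iff (a := a) (b := b) (c := c)
    by_cases h₃ : -a ≤ sadd b c
    · simp only [carryAdd, h₁, h₂, h₃, h, if_true, if_false, Prod.mk.injEq]
      exact ⟨by omega, sadd_mul_eq_mul_sadd (le_neg_comm.1 (not_le.1 h₁).le)
        (le_neg_comm.1 (not_le.1 h₂).le)⟩
    · simp only [carryAdd, h₁, h₂, h₃, h, if_false, Prod.mk.injEq]
      exact ⟨by omega, sadd_assoc a b c⟩

theorem carryAdd_double (x y : ℕ × C) :
    carryAdd (carryAdd x y) (carryAdd x y) = carryAdd (carryAdd x x) (carryAdd y y) := by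
  rw [carryAdd_assoc, carryAdd_assoc, ← carryAdd_assoc y, carryAdd_comm y x, carryAdd_assoc x y]

theorem fst_carryAdd (x y : ℕ × C) :
    (carryAdd x y).1 = x.1 + y.1 ∨ (carryAdd x y).1 = x.1 + y.1 + 1 := by
  unfold carryAdd; split_ifs <;> simp

/-- The integral part of `2 ^ n` times `x`. -/
def scaledFloor (n : ℕ) (x : ℕ × C) : ℕ := ((fun y => carryAdd y y)^[n] x).1

/-- Doubling is an endomorphism of a commutative semigroup. -/
theorem iterate_carryAdd (n : ℕ) (x y : ℕ × C) :
    (fun y => carryAdd y y)^[n] (carryAdd x y)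
      = carryAdd ((fun y => carryAdd y y)^[n] x) ((fun y => carryAdd y y)^[n] y) := by
  induction n generalizing x y with
  | zero => rfl
  | succ n ih => rw [Function.iterate_succ_apply, carryAdd_double, ih]; rfl

theorem scaledFloor_carryAdd (n : ℕ) (x y : ℕ × C) :
    scaledFloor n (carryAdd x y) = scaledFloor n x + scaledFloor n y ∨
      scaledFloor n (carryAdd x y) = scaledFloor n x + scaledFloor n y + 1 := by
  rw [scaledFloor, iterate_carryAdd]; exact fst_carryAdd _ _

theorem scaledFloor_succ (n : ℕ) (x : ℕ × C) :
    scaledFloor (n + 1) x = 2 * scaledFloor n x ∨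
      scaledFloor (n + 1) x = 2 * scaledFloor n x + 1 := by
  rw [scaledFloor, Function.iterate_succ_apply', two_mul]; exact fst_carryAdd _ _

/-- The real number represented by an element of `ℕ × C`. -/
noncomputable def size (x : ℕ × C) : ℝ := ⨆ n, (scaledFloor n x : ℝ) / 2 ^ n

/-- With `f` the floor of `2 ^ n` times `x`, the sequence `f / 2 ^ n` increases while `(f + 1) / 2 ^
n` decreases, so the former is bounded. -/
theorem tendsto_size (x : ℕ × C) :
    Tendsto (fun n => (scaledFloor n x : ℝ) / 2 ^ n) atTop (𝓝 (size x)) := by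
  have hs (n : ℕ) : (scaledFloor n x : ℝ) / 2 ^ n ≤ (scaledFloor (n + 1) x : ℝ) / 2 ^ (n + 1) ∧
      ((scaledFloor (n + 1) x : ℝ) + 1) / 2 ^ (n + 1) ≤ ((scaledFloor n x : ℝ) + 1) / 2 ^ n := by
    have h2 : (0 : ℝ) < 2 ^ n := by positivity
    rw [pow_succ, div_le_div_iff₀ h2 (by positivity), div_le_div_iff₀ (by positivity) h2]
    rcases scaledFloor_succ n x with h | h <;> rw [h] <;> push_cast <;> constructor <;> nlinarith
  have hanti : Antitone fun n => ((scaledFloor n x : ℝ) + 1) / 2 ^ n :=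
    antitone_nat_of_succ_le fun n => (hs n).2
  refine tendsto_atTop_ciSup (monotone_nat_of_le_succ fun n => (hs n).1)
    ⟨((scaledFloor 0 x : ℝ) + 1) / 2 ^ 0, ?_⟩
  rintro _ ⟨n, rfl⟩
  refine le_trans ?_ (hanti (Nat.zero_le n))
  dsimp only
  gcongr
  linarith

/-- Floors are additive up to a carry of at most `1`, an error of `1 / 2 ^ n` after scaling. -/
theorem size_carryAdd (x y : ℕ × C) : size (carryAdd x y) = size x + size y := by
  have h0 : Tendsto (fun n : ℕ => ((1 : ℝ) / 2) ^ n) atTop (𝓝 0) :=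
    tendsto_pow_atTop_nhds_zero_of_lt_one (by norm_num) (by norm_num)
  have h := (tendsto_size (carryAdd x y)).sub ((tendsto_size x).add (tendsto_size y))
  have h' : Tendsto (fun n => (scaledFloor n (carryAdd x y) : ℝ) / 2 ^ n -
      ((scaledFloor n x : ℝ) / 2 ^ n + (scaledFloor n y : ℝ) / 2 ^ n)) atTop (𝓝 0) := by
    refine squeeze_zero (fun n => ?_) (fun n => ?_) h0
    all_goals
      rw [← add_div, ← sub_div]
      rcases scaledFloor_carryAdd n x y with h | h <;> rw [h] <;> push_cast <;> simp
  linarith [tendsto_nhds_unique h h']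

theorem size_nonneg (x : ℕ × C) : 0 ≤ size x :=
  ge_of_tendsto' (tendsto_size x) fun n => by positivity

theorem scaledFloor_neg_one (n k : ℕ) : scaledFloor n (k, (-1 : C)) = 2 ^ n * k := by
  induction n generalizing k with
  | zero => simp [scaledFloor]
  | succ n ih =>
    have : carryAdd (k, (-1 : C)) (k, -1) = (2 * k, -1) := by
      have h : ¬ (1 : C) ≤ -1 := fun h => neg_one_ne_one (le_antisymm (neg_one_le _) h)
      simp [carryAdd, h, sadd, two_mul]
    rw [scaledFloor, Function.iterate_succ_apply, this]
    change scaledFloor n (2 * k, (-1 : C)) = _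
    rw [ih, pow_succ, mul_assoc]

theorem size_neg_one (k : ℕ) : size (k, (-1 : C)) = k := by
  simp [size, scaledFloor_neg_one]

theorem size_one : size (0, (1 : C)) = 1 := by
  -- This sum carries to `(1, -1)`, whose size is known; the floors of `(0, 1)` itself are `2 ^ n -
  -- 1` and never reach the limit.
  have h := size_carryAdd (0, (1 : C)) (0, -1)
  simpa [carryAdd, size_neg_one] using h.symm

theorem size_neg (a : C) : size (0, -a) = 1 - size (0, a) := by
  have h := size_carryAdd (0, a) (0, -a)
  have : carryAdd (0, a) (0, -a) = (1, -1) := by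
    simp [carryAdd, mul_eq_neg_one (a := a) (b := -a) (by simp)]
  rw [this, size_neg_one] at h
  push_cast at h
  linarith

theorem size_le_one (a : C) : size (0, a) ≤ 1 := by
  linarith [size_neg a, size_nonneg (0, -a)]

theorem size_mul (a b : C) : size (0, a * b) = max 0 (size (0, a) + size (0, b) - 1) := by
  have h := size_carryAdd (0, a) (0, b)
  by_cases hab : -a ≤ b
  · have h1 := size_carryAdd (0, (1 : C)) (0, a * b)
    have h2 : carryAdd (0, (1 : C)) (0, a * b) = (1, a * b) := by
      simp [carryAdd, neg_one_le]
    rw [h2, size_one] at h1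
    simp only [carryAdd, hab, if_true, zero_add] at h
    rw [h1] at h
    have := size_nonneg (0, a * b)
    rw [max_eq_right] <;> linarith
  · rw [mul_eq_neg_one (le_neg_comm.1 (not_le.1 hab).le), size_neg_one]
    simp only [carryAdd, hab, if_false, zero_add] at h
    have := size_le_one (sadd a b)
    rw [max_eq_left] <;> push_cast <;> linarith

end LukChain

/-! ### Linear theories and valuations in the unit interval -/

/-- Evaluations in `[0,1]` commuting with the propositional connectives. -/
structure IsValuation (v : Formula → unitInterval) : Prop where
  zero : v zero = 0
  conj : ∀ a b, v (conj a b) = lukConj (v a) (v b)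
  imp : ∀ a b, v (imp a b) = lukImp (v a) (v b)

/-- Interderivability modulo a theory. -/
def IsTheory.setoid {S : Set Formula} (h : IsTheory S) : Setoid Formula where
  r a b := imp a b ∈ S ∧ imp b a ∈ S
  iseqv := ⟨fun a => ⟨h.refl a, h.refl a⟩, fun hab => ⟨hab.2, hab.1⟩,
    fun hab hbc => ⟨h.trans hab.1 hbc.1, h.trans hbc.2 hab.2⟩⟩

/-- The Lindenbaum algebra of a consistent linear theory. -/
noncomputable abbrev IsTheory.lukChain {S : Set Formula} (h : IsTheory S)
    (htotal : ∀ a b, imp a b ∈ S ∨ imp b a ∈ S) (hzero : zero ∉ S) :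
    LukChain (Quotient h.setoid) :=
  letI : LinearOrder (Quotient h.setoid) :=
    { le := Quotient.lift₂ (fun a b => imp a b ∈ S) fun _ _ _ _ ha hb =>
        propext ⟨fun hab => h.trans ha.2 (h.trans hab hb.1),
          fun hab => h.trans ha.1 (h.trans hab hb.2)⟩
      le_refl := by rintro ⟨a⟩; exact h.refl a
      le_trans := by rintro ⟨a⟩ ⟨b⟩ ⟨c⟩ hab hbc; exact h.trans hab hbc
      le_antisymm := by rintro ⟨a⟩ ⟨b⟩ hab hba; exact Quotient.sound ⟨hab, hba⟩
      le_total := by rintro ⟨a⟩ ⟨b⟩; exact htotal a b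
      toDecidableLE := Classical.decRel _ }
  letI : CommMonoid (Quotient h.setoid) :=
    { mul := Quotient.map₂ conj fun _ _ ha _ _ hb =>
        ⟨h.conj_mono ha.1 hb.1, h.conj_mono ha.2 hb.2⟩
      one := ⟦one⟧
      mul_assoc := by
        rintro ⟨a⟩ ⟨b⟩ ⟨c⟩; exact Quotient.sound ⟨h.conj_assoc a b c, h.conj_assoc' a b c⟩
      mul_comm := by rintro ⟨a⟩ ⟨b⟩; exact Quotient.sound ⟨h.conj_comm a b, h.conj_comm b a⟩
      one_mul := by
        rintro ⟨a⟩
        exact Quotient.sound ⟨h.conj_right _ a, h.mp (h.refl zero) (h.imp_conj_iff.1 (h.refl _))⟩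
      mul_one := by
        rintro ⟨a⟩
        exact Quotient.sound ⟨h.conj_left a _, h.trans
          (h.mp (h.refl zero) (h.imp_conj_iff.1 (h.refl _))) (h.conj_comm _ _)⟩ }
  letI : InvolutiveNeg (Quotient h.setoid) :=
    { neg := Quotient.map neg fun _ _ ha => ⟨h.neg_mono ha.2, h.neg_mono ha.1⟩
      neg_neg := by
        rintro ⟨a⟩; exact Quotient.sound ⟨h.neg_neg_imp a, h.imp_neg_neg a⟩ }
  { le_one' := by rintro ⟨a⟩; exact h.weaken (h.refl zero) a
    mul_le_iff := by
      rintro ⟨a⟩ ⟨b⟩ ⟨c⟩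
      exact h.imp_conj_iff.trans ⟨fun hh => h.trans hh (h.imp_neg_conj_neg b c),
        fun hh => h.trans hh (h.neg_conj_neg_imp b c)⟩
    mul_residuum := by
      rintro ⟨a⟩ ⟨b⟩
      have h1 : imp (conj a (neg (conj a (neg b)))) (conj a (imp a b)) ∈ S :=
        h.conj_mono_right a (h.neg_conj_neg_imp a b)
      have h2 : imp (conj a (imp a b)) (conj a (neg (conj a (neg b)))) ∈ S :=
        h.conj_mono_right a (h.imp_neg_conj_neg a b)
      rcases htotal a b with hab | hba
      · refine Eq.trans (Quotient.sound ⟨h.trans h1 (h.conj_left a _), ?_⟩) (min_eq_left hab).symm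
        exact h.trans (h.trans (h.mp hab (h.imp_conj_iff.1 (h.refl _))) (h.conj_comm _ _)) h2
      · refine Eq.trans (Quotient.sound ⟨h.trans h1 (h.imp_elim' a b), ?_⟩) (min_eq_right hba).symm
        exact h.trans (h.trans (h.mp hba (h.imp_conj_iff.1 (h.refl _))) (h.conj_comm _ _))
          (h.trans (h.luk (.div b a)) h2)
    neg_one_ne_one := fun he => hzero <| by
      have h1 := (Quotient.exact he).2
      exact h.mp (h.refl zero) (h.mp (h.refl zero) h1) }

theorem IsTheory.exists_valuation {S : Set Formula} (h : IsTheory S)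
    (htotal : ∀ a b, Formula.imp a b ∈ S ∨ Formula.imp b a ∈ S) (hzero : Formula.zero ∉ S) :
    ∃ v, IsValuation v ∧ ∀ a ∈ S, v a = 1 := by
  let _ := h.lukChain htotal hzero
  let q (a : Formula) : Quotient h.setoid := Quotient.mk _ a
  have hneg (a : Formula) : q (neg a) = - q a := rfl
  have hconj (a b : Formula) : q (Formula.conj a b) = q a * q b := rfl
  have htrue {a : Formula} (ha : a ∈ S) : q a = 1 :=
    Quotient.sound ⟨h.weaken (h.refl _) a, h.weaken ha _⟩
  refine ⟨fun a => ⟨LukChain.size (0, q a), LukChain.size_nonneg _, LukChain.size_le_one _⟩,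
    ⟨?_, fun a b => ?_, fun a b => ?_⟩, fun a ha => ?_⟩ <;> apply Subtype.ext <;> dsimp only
  · have : q Formula.zero = -1 := by
      have h1 : q (neg Formula.zero) = 1 := rfl
      rw [← h1, hneg, neg_neg]
    rw [this, LukChain.size_neg_one]
    simp
  · rw [hconj, LukChain.size_mul]; rfl
  · have : q (Formula.imp a b) = -(q a * -q b) :=
      Quotient.sound ⟨h.imp_neg_conj_neg a b, h.neg_conj_neg_imp a b⟩
    rw [this, LukChain.size_neg, LukChain.size_mul, LukChain.size_neg]
    simp only [lukImp]
    rw [← sub_self (1 : ℝ), max_def, min_def]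
    split_ifs <;> linarith
  · rw [htrue ha, LukChain.size_one]; rfl

/-- Derivability from `S` in Łukasiewicz logic. -/
inductive LukDer (S : Set Formula) : Formula → Prop
  | hyp {a : Formula} (ha : a ∈ S) : LukDer S a
  | luk {a : Formula} (ha : LukAxiom a) : LukDer S a
  | mp {a b : Formula} (ha : LukDer S a) (hab : LukDer S (imp a b)) : LukDer S b

theorem isTheory_lukDer (S : Set Formula) : IsTheory {a | LukDer S a} := ⟨.luk, .mp⟩

/-- Induction on the derivation with the side disjunct `b` carried along; this replaces a deduction
theorem, in which the number of uses of `a` would matter. -/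
theorem IsTheory.or_of_lukDer {S : Set Formula} (h : IsTheory S) {a b c : Formula}
    (hab : or a b ∈ S) (hc : LukDer (insert a S) c) : or c b ∈ S := by
  induction hc with
  | hyp hc =>
    rcases hc with rfl | hc
    · exact hab
    · exact h.mp hc (h.or_left _ _)
  | luk hc => exact h.mp (h.luk hc) (h.or_left _ _)
  | mp _ _ ih₁ ih₂ => exact h.or_mono_left (h.imp_elim' _ _) (h.or_conj ih₁ ih₂)

/-- Take `P` maximal among theories omitting `c`. If both `a → b` and `b → a` were missing, each
would yield `c`, and prelinearity would give `c ∨ c`. -/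
theorem IsTheory.exists_linear {T : Set Formula} (h : IsTheory T) {c : Formula} (hc : c ∉ T) :
    ∃ P, T ⊆ P ∧ IsTheory P ∧ c ∉ P ∧ ∀ a b, Formula.imp a b ∈ P ∨ Formula.imp b a ∈ P := by
  obtain ⟨P, hTP, hP⟩ := zorn_subset_nonempty {P | IsTheory P ∧ c ∉ P} (fun C hC hchain hne => by
    refine ⟨⋃₀ C, ⟨⟨fun ha => ?_, fun {a b} ha hab => ?_⟩, ?_⟩, fun s => Set.subset_sUnion_of_mem⟩
    · obtain ⟨P, hP⟩ := hne
      exact ⟨P, hP, (hC hP).1.luk ha⟩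
    · obtain ⟨P, hP, ha⟩ := ha
      obtain ⟨Q, hQ, hab⟩ := hab
      rcases hchain.total hP hQ with hPQ | hQP
      · exact ⟨Q, hQ, (hC hQ).1.mp (hPQ ha) hab⟩
      · exact ⟨P, hP, (hC hP).1.mp ha (hQP hab)⟩
    · rintro ⟨P, hP, hcP⟩
      exact (hC hP).2 hcP) T ⟨h, hc⟩
  have hPt : IsTheory P := hP.prop.1
  have hmax {a : Formula} (ha : a ∉ P) : LukDer (insert a P) c := by
    by_contra hn
    exact ha (hP.le_of_ge (y := {x | LukDer (insert a P) x}) ⟨isTheory_lukDer _, hn⟩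
      (fun x hx => .hyp (Or.inr hx)) (.hyp (Or.inl rfl)))
  refine ⟨P, hTP, hPt, hP.prop.2, fun a b => ?_⟩
  by_contra! hab
  have h1 := hPt.or_of_lukDer (hPt.imp_or_imp a b) (hmax hab.1)
  have h2 := hPt.or_of_lukDer (hPt.or_symm h1) (hmax hab.2)
  exact hP.prop.2 (hPt.or_elim h2 (hPt.refl c) (hPt.refl c))

/-- Omitting `a → ¬a` from a linear theory forces `¬a → a` into it, and this non-strict inequality
survives the passage to the standard part. -/
theorem IsTheory.exists_valuation_of_notMem {T : Set Formula} (h : IsTheory T) {a : Formula}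
    (ha : Formula.imp a (neg a) ∉ T) :
    ∃ v, IsValuation v ∧ (∀ b ∈ T, v b = 1) ∧ (1 : ℝ) / 2 ≤ v a := by
  obtain ⟨P, hTP, hP, haP, htotal⟩ := h.exists_linear ha
  obtain ⟨v, hv, hvP⟩ := hP.exists_valuation htotal fun hz => haP (hP.mp hz (hP.luk (.exFalso _)))
  refine ⟨v, hv, fun b hb => hvP b (hTP hb), ?_⟩
  have h1 := hvP _ ((htotal a (neg a)).resolve_left haP)
  rw [neg, hv.imp, hv.imp, hv.zero] at h1
  have h2 := congrArg Subtype.val h1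
  simp only [lukImp] at h2
  have h3 := (v a).2.2
  have h4 := (v a).2.1
  simp only [Set.Icc.coe_zero, Set.Icc.coe_one, add_zero] at h2
  rw [min_eq_left_iff, min_eq_right (by linarith)] at h2
  linarith

/-! ### Infinitary derivations and archimedean extensions -/

/-- Well-founded derivations in `S5(Ł)_∞`. -/
inductive Der (Γ : Set Formula) : Formula → Prop
  | hyp {a : Formula} (ha : a ∈ Γ) : Der Γ a
  | ax {a : Formula} (ha : S5Axiom a) : Der Γ a
  | rule {P : Set Formula} {a : Formula} (hr : S5Rule P a) (hP : ∀ b ∈ P, Der Γ b) : Der Γ a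

theorem isModalCombination_one : IsModalCombination one := .imp .zero .zero

theorem Formula.IsModalCombination.or {a b : Formula} (ha : IsModalCombination a)
    (hb : IsModalCombination b) : IsModalCombination (Formula.or a b) :=
  .conj (.imp (.imp ha hb) hb) (.imp (.imp (.imp ha hb) hb) (.imp (.imp hb ha) ha))

theorem Formula.IsModalCombination.neg {a : Formula} (ha : IsModalCombination a) :
    IsModalCombination (Formula.neg a) := .imp ha .zero

theorem Formula.IsModalCombination.pow {a : Formula} (ha : IsModalCombination a) :
    ∀ n, IsModalCombination (Formula.pow a n)
  | 0 => isModalCombination_one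
  | 1 => ha
  | n + 2 => .conj (pow ha (n + 1)) ha

theorem IsTheory.pow_succ_imp {S : Set Formula} (h : IsTheory S) (a : Formula) :
    ∀ n, Formula.imp (Formula.pow a (n + 1)) (Formula.conj (Formula.pow a n) a) ∈ S
  | 0 => h.mp (h.refl Formula.zero) (h.imp_conj_iff.1 (h.refl _))
  | _ + 1 => h.refl _

/-- A theory containing the modal axioms and closed under Necessitation. -/
structure IsModalTheory (S : Set Formula) : Prop extends IsTheory S where
  ax : ∀ {a}, S5Axiom a → a ∈ S
  nec : ∀ {a}, a ∈ S → box a ∈ S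

namespace IsModalTheory

variable {S : Set Formula} {a b : Formula}

theorem imp_box (h : IsModalTheory S) (ha : IsModalCombination a) (hab : imp a b ∈ S) :
    imp a (box b) ∈ S :=
  h.mp (h.nec hab) (h.ax (.box_imp b ha))

theorem dia_imp (h : IsModalTheory S) (hb : IsModalCombination b) (hab : imp a b ∈ S) :
    imp (dia a) b ∈ S :=
  h.mp (h.nec hab) (h.ax (.dia_imp a hb))

theorem box_imp (h : IsModalTheory S) (a : Formula) : imp (box a) a ∈ S := h.ax (.box_elim a)

theorem imp_dia (h : IsModalTheory S) (a : Formula) : imp a (dia a) ∈ S := h.ax (.dia_intro a)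

theorem conj_box_imp (h : IsModalTheory S) (a b : Formula) :
    imp (conj (box a) (box (imp a b))) (box b) ∈ S :=
  h.imp_box (.conj (.box _) (.box _))
    (h.trans (h.conj_mono (h.box_imp _) (h.box_imp _)) (h.imp_elim' a b))

end IsModalTheory

namespace Der

variable {Γ Δ : Set Formula} {a b c : Formula}

theorem mono (hΓ : Γ ⊆ Δ) (h : Der Γ a) : Der Δ a := by
  induction h with
  | hyp ha => exact .hyp (hΓ ha)
  | ax ha => exact .ax ha
  | rule hr _ ih => exact .rule hr ih

theorem mp (ha : Der Γ a) (hab : Der Γ (imp a b)) : Der Γ b :=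
  .rule (.mp a b) (by rintro _ (rfl | rfl) <;> assumption)

theorem nec (ha : Der Γ a) : Der Γ (box a) :=
  .rule (.nec a) (by rintro _ rfl; exact ha)

theorem isModalTheory (Γ : Set Formula) : IsModalTheory {a | Der Γ a} :=
  { luk := fun ha => .ax (.luk ha), mp := mp, ax := .ax, nec := nec }

/-- Reasoning by cases over a disjunction of modal combinations. -/
theorem or_of_insert (ha : IsModalCombination a) (hb : IsModalCombination b)
    (hab : Der Γ (or a b)) (hc : Der (insert a Γ) c) : Der Γ (or (box c) b) := by
  have h := isModalTheory Γ
  have hmem {x : Formula} (hx : Der Γ x) : Der Γ (Formula.or (box x) b) :=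
    h.mp (h.nec hx) (h.or_left _ _)
  induction hc with
  | hyp hc =>
    rcases hc with rfl | hc
    · exact h.or_mono_left (h.imp_box ha (h.refl _)) hab
    · exact hmem (.hyp hc)
  | ax hc => exact hmem (.ax hc)
  | rule hr _ ih =>
    cases hr with
    | mp c =>
      exact h.or_mono_left (h.conj_box_imp c _)
        (h.or_conj (ih c (Or.inl rfl)) (ih _ (Or.inr rfl)))
    | nec c => exact h.or_mono_left (h.imp_box (.box _) (h.refl _)) (ih c rfl)
    | boxInf c α β =>
      -- The side formula `b` is absorbed into the disjunct `□φ` of `□Inf`, taking `φ := □c ∨ b`: a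
      -- modal combination implies its own box.
      have hcb : IsModalCombination (Formula.or (box c) b) := (IsModalCombination.box c).or hb
      have hprem (n : ℕ) : Der Γ (Formula.or (box (Formula.or (box c) b))
          (imp (box α) (Formula.pow (box β) n))) := by
        refine h.or_mono_left (h.imp_box hcb (h.refl _)) ?_
        refine h.or_elim (h.or_mono_left (h.box_imp _) (ih _ ⟨n, rfl⟩)) ?_ ?_
        · exact h.or_imp (h.trans (h.or_left _ _) (h.or_left _ _)) (h.or_right _ _)
        · exact h.trans (h.or_right _ _) (h.or_left _ _)
      have hconc := Der.rule (S5Rule.boxInf (Formula.or (box c) b) α β)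
        (by rintro _ ⟨n, rfl⟩; exact hprem n)
      refine h.or_mono_left (h.imp_box ((IsModalCombination.box c).or
        (.imp (.box α) (.conj (.box α) (.box β)))) (h.refl _)) ?_
      refine h.or_elim (h.or_mono_left (h.box_imp _) hconc) (h.or_imp ?_ (h.or_right _ _)) ?_
      · exact h.trans (h.or_left _ _) (h.or_left _ _)
      · exact h.trans (h.or_right _ _) (h.or_left _ _)

/-- Apply `□Inf` with `α := ¬□b` and `β := b`. By prelinearity either `¬□b → (□b)^n`, as the premise
requires, or `(□b)^n → ¬□b`, that is `¬(□b)^(n+1)`, which yields `a`. In the conclusion `□¬□b * □b`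
is absurd, so `□a ∨ □b` remains. -/
theorem of_insert_box (hb : Der (insert (box b) Γ) a)
    (hpow : ∀ n, Der (insert (neg (pow (box b) n)) Γ) a) : Der Γ a := by
  have h := isModalTheory Γ
  have hm : IsModalCombination (box b) := .box b
  have hprem (n : ℕ) :
      Der Γ (or (box a) (imp (box (neg (box b))) (pow (box b) n))) := by
    refine h.or_mono_right (h.imp_mono (h.box_imp _) (h.refl _)) ?_
    refine or_of_insert (hm.pow (n + 1)).neg (.imp hm.neg (hm.pow n)) ?_ (hpow (n + 1))
    refine h.or_mono_left ?_ (h.imp_or_imp (pow (box b) n) (neg (box b)))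
    exact h.trans (h.luk (.import_ _ _ _)) (h.neg_mono (h.pow_succ_imp _ n))
  have hconc := Der.rule (S5Rule.boxInf a (neg (box b)) b)
    (by rintro _ ⟨n, rfl⟩; exact hprem n)
  have hor : Der Γ (or (box a) (box b)) := by
    refine h.or_mono_right ?_ hconc
    refine h.trans (h.imp_mono (h.imp_box hm.neg (h.refl _)) (d := zero) ?_) (h.neg_neg_imp _)
    exact h.trans (h.conj_mono_left (h.box_imp _) _) (h.imp_elim _ _)
  have := or_of_insert hm (.box a) (h.or_symm hor) hb
  exact h.or_elim this (h.box_imp a) (h.box_imp a)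

end Der

/-- A numbering of formulas. -/
def Formula.code : Formula → ℕ
  | var n => Nat.pair 0 n
  | zero => Nat.pair 1 0
  | conj a b => Nat.pair 2 (Nat.pair a.code b.code)
  | imp a b => Nat.pair 3 (Nat.pair a.code b.code)
  | box a => Nat.pair 4 a.code
  | dia a => Nat.pair 5 a.code

theorem Formula.code_injective : Function.Injective code := by
  intro a
  induction a with
  | var n => rintro (_ | _ | _ | _ | _ | _) <;> simp [code]
  | zero => rintro (_ | _ | _ | _ | _ | _) <;> simp [code]
  | conj a b iha ihb =>
    rintro (_ | _ | ⟨c, d⟩ | _ | _ | _) <;> simp [code]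
    exact fun h₁ h₂ => ⟨iha h₁, ihb h₂⟩
  | imp a b iha ihb =>
    rintro (_ | _ | _ | ⟨c, d⟩ | _ | _) <;> simp [code]
    exact fun h₁ h₂ => ⟨iha h₁, ihb h₂⟩
  | box a ih => rintro (_ | _ | _ | _ | c | _) <;> simp [code]; exact fun h => ih h
  | dia a ih => rintro (_ | _ | _ | _ | _ | c) <;> simp [code]; exact fun h => ih h

/-- Decide the formulas one at a time, keeping `a` underivable. The union of the stages inherits
closure under the finitary rules only. -/
theorem exists_archimedean_theory {Γ : Set Formula} {a : Formula} (ha : ¬ Der Γ a) :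
    ∃ T, Γ ⊆ T ∧ IsModalTheory T ∧ a ∉ T ∧
      ∀ b, box b ∈ T ∨ ∃ n, neg (pow (box b) n) ∈ T := by
  have : Countable Formula := code_injective.countable
  have : Nonempty Formula := ⟨zero⟩
  obtain ⟨e, he⟩ := exists_surjective_nat Formula
  have step (Δ : {Δ // ¬ Der Δ a}) (b : Formula) : ∃ Δ' : {Δ // ¬ Der Δ a}, Δ.1 ⊆ Δ'.1 ∧
      (box b ∈ Δ'.1 ∨ ∃ n, neg (pow (box b) n) ∈ Δ'.1) := by
    by_contra! hn
    refine Δ.2 (Der.of_insert_box (b := b) ?_ fun n => ?_) <;> by_contra hd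
    · exact (hn ⟨_, hd⟩ (Set.subset_insert _ _)).1 (Set.mem_insert _ _)
    · exact (hn ⟨_, hd⟩ (Set.subset_insert _ _)).2 n (Set.mem_insert _ _)
  choose f hf hf' using step
  let s : ℕ → {Δ // ¬ Der Δ a} := fun n => Nat.rec ⟨Γ, ha⟩ (fun n Δ => f Δ (e n)) n
  have hs (n : ℕ) : s (n + 1) = f (s n) (e n) := rfl
  have hmono : Monotone fun n => (s n).1 :=
    monotone_nat_of_le_succ fun n => by rw [hs]; exact hf _ _
  refine ⟨{b | ∃ n, Der (s n).1 b}, fun b hb => ⟨0, .hyp hb⟩, ?_, fun ⟨n, hn⟩ => (s n).2 hn,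
    fun b => ?_⟩
  · exact
      { luk := fun hb => ⟨0, .ax (.luk hb)⟩
        mp := fun ⟨m, hm⟩ ⟨n, hn⟩ => ⟨max m n, (hm.mono (hmono (le_max_left m n))).mp
          (hn.mono (hmono (le_max_right m n)))⟩
        ax := fun hb => ⟨0, .ax hb⟩
        nec := fun ⟨n, hn⟩ => ⟨n, hn.nec⟩ }
  · obtain ⟨n, rfl⟩ := he b
    rcases hf' (s n) (e n) with h | ⟨k, h⟩
    · exact Or.inl ⟨n + 1, .hyp h⟩
    · exact Or.inr ⟨k, n + 1, .hyp h⟩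

/-! ### Well-founded derivations and transfinite sequences -/

/-- Derivability at a given ordinal stage. -/
inductive DerAt (Γ : Set Formula) : Ordinal.{0} → Formula → Prop
  | hyp {o : Ordinal.{0}} {a : Formula} (ha : a ∈ Γ) : DerAt Γ o a
  | ax {o : Ordinal.{0}} {a : Formula} (ha : S5Axiom a) : DerAt Γ o a
  | rule {o : Ordinal.{0}} {P : Set Formula} {a : Formula} (hr : S5Rule P a)
      (r : Formula → Ordinal.{0}) (hlt : ∀ b ∈ P, r b < o) (hP : ∀ b ∈ P, DerAt Γ (r b) b) :
      DerAt Γ o a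

theorem Der.exists_derAt {Γ : Set Formula} {a : Formula} (h : Der Γ a) : ∃ o, DerAt Γ o a := by
  induction h with
  | hyp ha => exact ⟨0, .hyp ha⟩
  | ax ha => exact ⟨0, .ax ha⟩
  | @rule P a hr _ ih =>
    have : ∀ b, ∃ o, b ∈ P → DerAt Γ o b := fun b => by
      by_cases hb : b ∈ P
      · exact (ih b hb).imp fun _ ho _ => ho
      · exact ⟨0, fun h => absurd h hb⟩
    choose r hr' using this
    exact ⟨_, .rule (o := ⨆ b, Order.succ (r b)) hr r
      (fun b _ => (Order.lt_succ (r b)).trans_le (Ordinal.le_iSup (fun b => Order.succ (r b)) b))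
      hr'⟩

/-- Stage `o` occupies the block of indices from `ω * o` to `ω * (o + 1)`, with each formula at the
offset given by its code. Unused indices hold the axiom `0̄ → 0̄`. -/
theorem Der.provable {Γ : Set Formula} {a : Formula} (h : Der Γ a) : Provable Γ a := by
  classical
  obtain ⟨o, ho⟩ := h.exists_derAt
  let ψ : Ordinal.{0} → Formula := fun i =>
    if h : ∃ b : Formula, (b.code : Ordinal.{0}) = i % Ordinal.omega0 ∧
      DerAt Γ (i / Ordinal.omega0) b then h.choose else imp zero zero
  have hψ {o : Ordinal.{0}} {b : Formula} (hb : DerAt Γ o b) :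
      ψ (Ordinal.omega0 * o + b.code) = b := by
    have hmod : (Ordinal.omega0 * o + b.code) % Ordinal.omega0 = b.code := by
      rw [Ordinal.mul_add_mod_self, Ordinal.mod_eq_of_lt (Ordinal.natCast_lt_omega0 _)]
    have hdiv : (Ordinal.omega0 * o + b.code) / Ordinal.omega0 = o := by
      rw [Ordinal.mul_add_div _ Ordinal.omega0_ne_zero,
        Ordinal.div_eq_zero_of_lt (Ordinal.natCast_lt_omega0 _), add_zero]
    have hex : ∃ c : Formula, (c.code : Ordinal.{0}) =
        (Ordinal.omega0 * o + b.code) % Ordinal.omega0 ∧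
        DerAt Γ ((Ordinal.omega0 * o + b.code) / Ordinal.omega0) c :=
      ⟨b, hmod.symm, by rwa [hdiv]⟩
    simp only [ψ]
    rw [dif_pos hex]
    exact code_injective (by exact_mod_cast hex.choose_spec.1.trans hmod)
  refine ⟨Ordinal.omega0 * o + a.code, ψ, fun i _ => ?_, hψ ho⟩
  by_cases hex : ∃ b : Formula, (b.code : Ordinal.{0}) = i % Ordinal.omega0 ∧
      DerAt Γ (i / Ordinal.omega0) b
  · have hi : ψ i = hex.choose := dif_pos hex
    rw [hi]
    cases hex.choose_spec.2 with
    | hyp h => exact Or.inl h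
    | ax h => exact Or.inr (Or.inl h)
    | @rule _ P _ hr r hlt hP =>
      refine Or.inr (Or.inr ⟨P, fun b hb => ⟨_, ?_, hψ (hP b hb)⟩, hr⟩)
      calc Ordinal.omega0 * r b + b.code < Ordinal.omega0 * r b + Ordinal.omega0 := by
            gcongr; exact Ordinal.natCast_lt_omega0 _
        _ = Ordinal.omega0 * Order.succ (r b) := (Ordinal.mul_succ _ _).symm
        _ ≤ Ordinal.omega0 * (i / Ordinal.omega0) := by
            gcongr; exact Order.succ_le_of_lt (hlt b hb)
        _ ≤ i := Ordinal.mul_div_le _ _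
  · have hi : ψ i = imp zero zero := dif_neg hex
    rw [hi]
    exact Or.inr (Or.inl (.luk (.exFalso zero)))

theorem Provable.der {Γ : Set Formula} {a : Formula} (h : Provable Γ a) : Der Γ a := by
  obtain ⟨ξ, ψ, hψ, rfl⟩ := h
  have (i : Ordinal.{0}) (hi : i ≤ ξ) : Der Γ (ψ i) := by
    induction i using WellFoundedLT.induction with
    | ind i ih =>
      rcases hψ i hi with h | h | ⟨P, hP, hr⟩
      · exact .hyp h
      · exact .ax h
      · refine .rule hr fun b hb => ?_
        obtain ⟨j, hj, rfl⟩ := hP hb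
        exact ih j hj ((le_of_lt hj).trans hi)
  exact this ξ le_rfl

/-! ### Arithmetic of valuations and separation by modal combinations -/

theorem coe_lukConj (a b : unitInterval) : (lukConj a b : ℝ) = max 0 ((a : ℝ) + b - 1) := rfl

theorem coe_lukImp (a b : unitInterval) : (lukImp a b : ℝ) = min 1 (1 - (a : ℝ) + b) := rfl

theorem lukImp_eq_one_iff {a b : unitInterval} : lukImp a b = 1 ↔ a ≤ b := by
  rw [Subtype.ext_iff, coe_lukImp, ← Subtype.coe_le_coe, Set.Icc.coe_one, min_eq_left_iff]
  constructor <;> intro h <;> linarith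

theorem le_lukImp_iff {a b c : unitInterval} : a ≤ lukImp b c ↔ lukConj a b ≤ c := by
  rw [← Subtype.coe_le_coe, ← Subtype.coe_le_coe, coe_lukImp, coe_lukConj, le_min_iff, max_le_iff]
  exact ⟨fun h => ⟨c.2.1, by linarith⟩, fun h => ⟨a.2.2, by linarith⟩⟩

theorem lukConj_comm (a b : unitInterval) : lukConj a b = lukConj b a :=
  Subtype.ext (by rw [coe_lukConj, coe_lukConj, add_comm (a : ℝ)])

theorem lukConj_lukImp (a b : unitInterval) : lukConj a (lukImp a b) = a ⊓ b := by
  apply Subtype.ext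
  have h1 := a.2.2
  have h2 := b.2.1
  have h3 := a.2.1
  rw [coe_lukConj, coe_lukImp]
  rcases le_total a b with h | h
  · rw [inf_eq_left.2 h]
    have : (a : ℝ) ≤ b := h
    rw [min_eq_left (by linarith), max_eq_right (by linarith)]
    ring
  · rw [inf_eq_right.2 h]
    have : (b : ℝ) ≤ a := h
    rw [min_eq_right (by linarith), max_eq_right (by linarith)]
    ring

namespace IsValuation

variable {v w : Formula → unitInterval} {a b : Formula}

theorem coe_conj (hv : IsValuation v) (a b : Formula) :
    (v (Formula.conj a b) : ℝ) = max 0 ((v a : ℝ) + v b - 1) := by rw [hv.conj, coe_lukConj]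

theorem coe_imp (hv : IsValuation v) (a b : Formula) :
    (v (Formula.imp a b) : ℝ) = min 1 (1 - (v a : ℝ) + v b) := by rw [hv.imp, coe_lukImp]

theorem coe_neg (hv : IsValuation v) (a : Formula) : (v (neg a) : ℝ) = 1 - v a := by
  rw [neg, hv.coe_imp, hv.zero, Set.Icc.coe_zero, add_zero, min_eq_right]
  linarith [(v a).2.1]

theorem le_of_imp (hv : IsValuation v) (h : v (Formula.imp a b) = 1) : v a ≤ v b :=
  lukImp_eq_one_iff.1 (by rw [← hv.imp, h])

theorem pow_eq_one (hv : IsValuation v) (ha : v a = 1) : ∀ n, v (pow a n) = 1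
  | 0 => by rw [pow, one, hv.imp]; exact lukImp_eq_one_iff.2 le_rfl
  | 1 => ha
  | n + 2 => by
    apply Subtype.ext
    rw [pow, hv.coe_conj, pow_eq_one hv ha (n + 1), ha]
    norm_num

/-- If two valuations differ on some modal combination, then on one with value `1` under the
smaller of the two. -/
theorem exists_separating (hv : IsValuation v) (hw : IsValuation w) (n : ℕ)
    (ha : IsModalCombination a) (h : (1 : ℝ) / 2 ^ n ≤ w a - v a) :
    ∃ b, IsModalCombination b ∧ v b = 1 ∧ w b ≠ 1 := by
  have h0v := (v a).2.1
  have h1v := (v a).2.2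
  have h0w := (w a).2.1
  have h1w := (w a).2.2
  induction n generalizing a with
  | zero =>
    refine ⟨neg a, ha.neg, Subtype.ext ?_, fun hb => ?_⟩
    · rw [hv.coe_neg, Set.Icc.coe_one]; linarith
    · have := hw.coe_neg a
      rw [hb, Set.Icc.coe_one] at this
      linarith
  | succ n ih =>
    have hpos : (0 : ℝ) < 1 / 2 ^ n := by positivity
    have h2 : (1 : ℝ) / 2 ^ (n + 1) = 1 / 2 ^ n / 2 := by rw [pow_succ, div_div]
    rw [h2] at h
    -- The gap doubles under `x ↦ 2x` (the formula `¬a → a`) if both values are at most `1/2`, and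
    -- under `x ↦ 2x - 1` (the formula `a * a`) if both are at least `1/2`. If they straddle `1/2`,
    -- then `¬(a * a)` already separates.
    by_cases hlow : (w a : ℝ) ≤ 1 / 2
    · refine ih (a := Formula.imp (neg a) a) (.imp ha.neg ha) ?_ (v _).2.1 (v _).2.2 (w _).2.1
        (w _).2.2
      rw [hv.coe_imp, hw.coe_imp, hv.coe_neg, hw.coe_neg, min_eq_right (by linarith),
        min_eq_right (by linarith)]
      linarith
    by_cases hhigh : 1 / 2 ≤ (v a : ℝ)
    · refine ih (a := Formula.conj a a) (.conj ha ha) ?_ (v _).2.1 (v _).2.2 (w _).2.1 (w _).2.2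
      rw [hv.coe_conj, hw.coe_conj, max_eq_right (by linarith), max_eq_right (by linarith)]
      linarith
    · refine ⟨neg (Formula.conj a a), (IsModalCombination.conj ha ha).neg, Subtype.ext ?_,
        fun hb => ?_⟩
      · rw [hv.coe_neg, hv.coe_conj, max_eq_left (by linarith), Set.Icc.coe_one, sub_zero]
      · have := hw.coe_neg (Formula.conj a a)
        rw [hb, hw.coe_conj, max_eq_right (by linarith), Set.Icc.coe_one] at this
        linarith

end IsValuation

/-- The `2 ^ n`-th power of a formula. -/
def Formula.iterSq (a : Formula) : ℕ → Formula
  | 0 => a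
  | n + 1 => conj (iterSq a n) (iterSq a n)

theorem IsValuation.coe_iterSq {v : Formula → unitInterval} (hv : IsValuation v) (a : Formula)
    (n : ℕ) : (v (iterSq a n) : ℝ) = max 0 (1 - 2 ^ n * (1 - (v a : ℝ))) := by
  induction n with
  | zero => simp [iterSq, (v a).2.1]
  | succ n ih =>
    rw [iterSq, hv.coe_conj, ih, pow_succ]
    rcases le_total 0 (1 - 2 ^ n * (1 - (v a : ℝ))) with h | h
    · rw [max_eq_right h]; congr 1; ring
    · rw [max_eq_left h, max_eq_left (by linarith), max_eq_left (by linarith)]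

/-! ### The canonical structure -/

/-- The valuations that are models of `T`. -/
def Point (T : Set Formula) : Type :=
  {v : Formula → unitInterval // IsValuation v ∧ ∀ a ∈ T, v a = 1}

namespace IsModalTheory

variable {T : Set Formula} {a b : Formula}

/-- Suppose a modal `b` has value `1` at `v` but not at `w`. Then `□b ∈ T` contradicts `w`, and
`¬(□b)^k ∈ T` contradicts `v`, since `b → □b ∈ T`. -/
theorem val_eq_of_modal (h : IsModalTheory T)
    (harch : ∀ b, box b ∈ T ∨ ∃ n, neg (pow (box b) n) ∈ T) (v w : Point T)
    (ha : IsModalCombination a) : v.1 a = w.1 a := by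
  have key (v w : Point T) : w.1 a ≤ v.1 a := by
    by_contra! hlt
    have hlt' : (0 : ℝ) < w.1 a - v.1 a := sub_pos.2 hlt
    obtain ⟨n, hn⟩ := exists_pow_lt_of_lt_one hlt' (by norm_num : (1 : ℝ) / 2 < 1)
    rw [one_div_pow] at hn
    obtain ⟨b, hb, hvb, hwb⟩ := v.2.1.exists_separating w.2.1 n ha hn.le
    rcases harch b with hT | ⟨k, hT⟩
    · exact hwb (w.2.2 b (h.mp hT (h.box_imp b)))
    · have h1 := v.2.1.le_of_imp (v.2.2 _ (h.imp_box hb (h.refl b)))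
      rw [hvb] at h1
      have h2 := v.2.1.coe_neg (pow (box b) k)
      rw [v.2.2 _ hT, v.2.1.pow_eq_one (le_antisymm unitInterval.le_one' h1) k] at h2
      norm_num at h2
  exact le_antisymm (key w v) (key v w)

theorem val_dia_le (h : IsModalTheory T)
    (harch : ∀ b, box b ∈ T ∨ ∃ n, neg (pow (box b) n) ∈ T) (v : Point T) {r : ℝ}
    (hr : ∀ w : Point T, (w.1 a : ℝ) ≤ r) : (v.1 (dia a) : ℝ) ≤ r := by
  by_contra! hlt
  have hr0 : 0 ≤ r := (v.1 a).2.1.trans (hr v)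
  set c := imp (dia a) a with hc
  have hdc : v.1 (dia c) = 1 := by
    -- Divisibility gives `a → ◇a * c`. Hence `◇a ≤ ◇a * ◇c` at `v`, and as `◇a` has positive value
    -- there, `◇c` must have value `1`.
    have h1 : imp a (conj (dia a) (dia c)) ∈ T :=
      h.trans (h.imp_and (h.refl a) (h.imp_dia a))
        (h.trans (h.trans (h.conj_mono_right a (h.weaken (h.imp_dia a) _)) (h.luk (.div _ _)))
          (h.conj_mono_right _ (h.imp_dia c)))
    have h2 := v.2.1.le_of_imp (v.2.2 _ (h.dia_imp (.conj (.dia a) (.dia c)) h1))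
    have h3 : (v.1 (dia a) : ℝ) ≤ v.1 (conj (dia a) (dia c)) := h2
    rw [v.2.1.coe_conj, le_max_iff] at h3
    refine Subtype.ext (le_antisymm (v.1 _).2.2 ?_)
    rw [Set.Icc.coe_one]
    rcases h3 with h3 | h3 <;> linarith
  have hdsq (n : ℕ) : v.1 (dia (iterSq c n)) = 1 := by
    induction n with
    | zero => exact hdc
    | succ n ih =>
      have h1 : imp (conj (dia (iterSq c n)) (dia (iterSq c n))) (dia (iterSq c (n + 1))) ∈ T :=
        h.mp (h.ax (.dia_conj (iterSq c n))) (h.imp_elim' _ _)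
      have h2 : (v.1 (conj (dia (iterSq c n)) (dia (iterSq c n))) : ℝ) ≤
        v.1 (dia (iterSq c (n + 1))) := v.2.1.le_of_imp (v.2.2 _ h1)
      rw [v.2.1.coe_conj, ih, Set.Icc.coe_one] at h2
      norm_num at h2
      exact le_antisymm unitInterval.le_one' h2
  -- At every point `c` is at most `1` minus the gap, so this `n` makes `c^(2^n)` vanish everywhere;
  -- omitting `hT` from `T` would give a point where it is at least `1/2`.
  obtain ⟨n, hn⟩ := pow_unbounded_of_one_lt (1 / ((v.1 (dia a) : ℝ) - r)) one_lt_two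
  rw [div_lt_iff₀ (by linarith)] at hn
  have hT : imp (iterSq c n) (neg (iterSq c n)) ∈ T := by
    by_contra hnot
    obtain ⟨w, hw, hwT, hle⟩ := h.exists_valuation_of_notMem hnot
    have h1 := hr ⟨w, hw, hwT⟩
    have h2 := congrArg Subtype.val (h.val_eq_of_modal harch ⟨w, hw, hwT⟩ v (.dia a))
    dsimp only at h1 h2
    have h3 : (v.1 (dia a) : ℝ) - r ≤ 1 - w c := by
      rw [hc, hw.coe_imp, h2, min_eq_right (by linarith)]
      linarith
    rw [hw.coe_iterSq, max_eq_left] at hle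
    · norm_num at hle
    · have : (2 : ℝ) ^ n * (v.1 (dia a) - r) ≤ 2 ^ n * (1 - w c) := by gcongr
      linarith
  have h1 := v.2.1.le_of_imp
    (v.2.2 _ (h.dia_imp .zero (h.imp_conj_iff.2 hT : imp (iterSq c (n + 1)) zero ∈ T)))
  rw [← iterSq, hdsq, v.2.1.zero] at h1
  exact absurd h1 (by simp)

end IsModalTheory

/-- The structure formed by the valuations that are models of `T`. -/
def canonicalStructure (T : Set Formula) (hT : Nonempty (Point T)) : StdStructure.{u} where
  X := ULift.{u} (Point T)
  nonempty := ⟨⟨hT.some⟩⟩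
  e v p := v.down.1 (var p)

/-- The valuation underlying a point of the canonical structure. -/
def canonicalPoint {T : Set Formula} {hT : Nonempty (Point T)}
    (v : (canonicalStructure.{u} T hT).X) : Point T := ULift.down v

theorem truth_canonicalStructure {T : Set Formula} (h : IsModalTheory T)
    (harch : ∀ b, box b ∈ T ∨ ∃ n, neg (pow (box b) n) ∈ T) (hT : Nonempty (Point T))
    (a : Formula) (v : (canonicalStructure.{u} T hT).X) :
    (canonicalStructure.{u} T hT).truth a v = (canonicalPoint v).1 a := by
  have hv := (canonicalPoint v).2
  induction a generalizing v with
  | var n => rfl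
  | zero => exact hv.1.zero.symm
  | conj a b iha ihb => rw [StdStructure.truth, iha v hv, ihb v hv, hv.1.conj]
  | imp a b iha ihb => rw [StdStructure.truth, iha v hv, ihb v hv, hv.1.imp]
  | box a ih =>
    rw [StdStructure.truth]
    apply le_antisymm
    · have h1 : imp (neg (dia (neg a))) (box a) ∈ T :=
        h.imp_box (IsModalCombination.dia _).neg
          (h.trans (h.neg_mono (h.imp_dia _)) (h.neg_neg_imp a))
      refine le_trans ?_ (hv.1.le_of_imp (hv.2 _ h1))
      rw [← Subtype.coe_le_coe, hv.1.coe_neg, le_sub_comm]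
      refine h.val_dia_le harch (canonicalPoint v) fun w => ?_
      rw [w.2.1.coe_neg, sub_le_sub_iff_left, Subtype.coe_le_coe]
      exact (iInf_le _ (ULift.up w)).trans_eq (ih (ULift.up w) w.2)
    · refine le_iInf fun w => ?_
      rw [ih w (canonicalPoint w).2, h.val_eq_of_modal harch _ (canonicalPoint w) (.box a)]
      exact (canonicalPoint w).2.1.le_of_imp ((canonicalPoint w).2.2 _ (h.box_imp a))
  | dia a ih =>
    rw [StdStructure.truth]
    apply le_antisymm
    · refine iSup_le fun w => ?_
      rw [ih w (canonicalPoint w).2, h.val_eq_of_modal harch _ (canonicalPoint w) (.dia a)]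
      exact (canonicalPoint w).2.1.le_of_imp ((canonicalPoint w).2.2 _ (h.imp_dia a))
    · refine h.val_dia_le harch (canonicalPoint v) fun w => ?_
      rw [Subtype.coe_le_coe]
      exact (ih (ULift.up w) w.2).symm.trans_le
        (le_iSup ((canonicalStructure.{u} T hT).truth a) (ULift.up w))

theorem Entails.provable {Γ : Set Formula} {a : Formula} (hent : Entails.{u} Γ a) :
    Provable Γ a := by
  refine Der.provable (by_contra fun hn => ?_)
  obtain ⟨T, hΓT, h, haT, harch⟩ := exists_archimedean_theory hn
  have hz : imp one (neg one) ∉ T := fun hz => haT <|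
    h.mp (h.mp (h.refl zero) (h.mp (h.refl zero) hz)) (h.luk (.exFalso a))
  obtain ⟨v, hv, hvT, -⟩ := h.exists_valuation_of_notMem hz
  have hne : Nonempty (Point T) := ⟨v, hv, hvT⟩
  have htruth := truth_canonicalStructure.{u} h harch hne
  have hmodel : (canonicalStructure.{u} T hne).IsModel {a} :=
    hent _ fun b hb y => (htruth b y).trans ((canonicalPoint y).2.2 b (hΓT hb))
  have hbox : v (box a) = 1 := by
    refine (htruth (box a) (ULift.up ⟨v, hv, hvT⟩)).symm.trans ?_
    exact le_antisymm unitInterval.le_one' (le_iInf fun y => (hmodel a rfl y).ge)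
  -- Although points only reflect `T` up to infinitesimals, the dichotomy for `□a` turns its value
  -- `1` into membership in `T`.
  rcases harch a with hT | ⟨n, hT⟩
  · exact haT (h.mp hT (h.box_imp a))
  · have h1 := hv.coe_neg (pow (box a) n)
    rw [hvT _ hT, hv.pow_eq_one hbox n] at h1
    norm_num at h1

/-! ### Soundness -/

namespace StdStructure

variable (K : StdStructure.{u})

theorem truth_imp_eq_one_iff {a b : Formula} {x : K.X} :
    K.truth (imp a b) x = 1 ↔ K.truth a x ≤ K.truth b x := by
  rw [truth, lukImp_eq_one_iff]

theorem truth_and (a b : Formula) (x : K.X) :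
    K.truth (and a b) x = K.truth a x ⊓ K.truth b x := lukConj_lukImp _ _

theorem truth_or (a b : Formula) (x : K.X) :
    K.truth (or a b) x = K.truth a x ⊔ K.truth b x := by
  rw [Formula.or, truth_and]
  simp only [truth]
  have key {s t : unitInterval} (h : s ≤ t) :
      lukImp (lukImp s t) t = t ∧ lukImp (lukImp t s) s = t := by
    have h' : (s : ℝ) ≤ t := h
    have := s.2.1
    have := t.2.2
    constructor <;> apply Subtype.ext <;> simp only [coe_lukImp]
    · rw [min_eq_left (a := 1) (b := 1 - (s : ℝ) + t) (by linarith),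
        min_eq_right (by linarith)]
      ring
    · rw [min_eq_right (a := 1) (b := 1 - (t : ℝ) + s) (by linarith), min_eq_right (by linarith)]
      ring
  rcases le_total (K.truth a x) (K.truth b x) with h | h
  · rw [(key h).1, (key h).2, inf_idem, sup_eq_right.2 h]
  · rw [(key h).1, (key h).2, inf_idem, sup_eq_left.2 h]

theorem truth_eq_of_modal {ν : Formula} (hν : IsModalCombination ν) (x y : K.X) :
    K.truth ν x = K.truth ν y := by
  induction hν with
  | box | dia | zero => rfl
  | conj _ _ ih₁ ih₂ | imp _ _ ih₁ ih₂ => rw [truth, truth, ih₁, ih₂]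

theorem truth_lukAxiom {a : Formula} (ha : LukAxiom a) (x : K.X) : K.truth a x = 1 := by
  cases ha with
  | conj_comm φ ψ => rw [truth_imp_eq_one_iff, truth, truth, lukConj_comm]
  | div φ ψ =>
    rw [truth_imp_eq_one_iff]
    exact (K.truth_and φ ψ x).trans (inf_comm _ _) |>.trans (K.truth_and ψ φ x).symm |>.le
  | exFalso φ => exact (K.truth_imp_eq_one_iff).2 (K.truth φ x).2.1
  | conj_left φ ψ =>
    rw [truth_imp_eq_one_iff, truth, ← Subtype.coe_le_coe, coe_lukConj]
    exact max_le (K.truth φ x).2.1 (by linarith [(K.truth ψ x).2.2])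
  | dne φ =>
    rw [truth_imp_eq_one_iff, ← Subtype.coe_le_coe]
    simp only [neg, truth, coe_lukImp, Set.Icc.coe_zero, add_zero]
    have := (K.truth φ x).2.1
    rw [min_eq_right (a := 1) (b := 1 - (K.truth φ x : ℝ)) (by linarith)]
    exact (min_le_right _ _).trans (by linarith)
  | import_ φ ψ χ =>
    rw [truth_imp_eq_one_iff, ← Subtype.coe_le_coe]
    have h1 := (K.truth φ x).2
    have h2 := (K.truth ψ x).2
    have h3 := (K.truth χ x).2
    simp only [truth, coe_lukImp, coe_lukConj, max_def, min_def]
    simp only [Set.mem_Icc] at h1 h2 h3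
    split_ifs <;> linarith
  | export_ φ ψ χ =>
    rw [truth_imp_eq_one_iff, ← Subtype.coe_le_coe]
    have h1 := (K.truth φ x).2
    have h2 := (K.truth ψ x).2
    have h3 := (K.truth χ x).2
    simp only [truth, coe_lukImp, coe_lukConj, max_def, min_def]
    simp only [Set.mem_Icc] at h1 h2 h3
    split_ifs <;> linarith
  | trans φ ψ χ =>
    rw [truth_imp_eq_one_iff, ← Subtype.coe_le_coe]
    have h1 := (K.truth φ x).2
    have h2 := (K.truth ψ x).2
    have h3 := (K.truth χ x).2
    simp only [truth, coe_lukImp, min_def]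
    simp only [Set.mem_Icc] at h1 h2 h3
    split_ifs <;> linarith
  | prelin φ ψ χ =>
    rw [truth_imp_eq_one_iff, ← Subtype.coe_le_coe]
    have h1 := (K.truth φ x).2
    have h2 := (K.truth ψ x).2
    have h3 := (K.truth χ x).2
    simp only [truth, coe_lukImp, min_def]
    simp only [Set.mem_Icc] at h1 h2 h3
    split_ifs <;> linarith

theorem truth_s5Axiom {a : Formula} (ha : S5Axiom a) (x : K.X) : K.truth a x = 1 := by
  have := K.nonempty
  cases ha with
  | luk h => exact K.truth_lukAxiom h x
  | box_elim φ => exact K.truth_imp_eq_one_iff.2 (iInf_le (fun y => K.truth φ y) x)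
  | dia_intro φ => exact K.truth_imp_eq_one_iff.2 (le_iSup (fun y => K.truth φ y) x)
  | @box_imp ν φ hν =>
    rw [truth_imp_eq_one_iff]
    simp only [truth]
    rw [le_lukImp_iff]
    refine le_iInf fun y => ?_
    rw [← le_lukImp_iff, K.truth_eq_of_modal hν x y]
    exact iInf_le (fun y => lukImp (K.truth ν y) (K.truth φ y)) y
  | @dia_imp ν φ hν =>
    rw [truth_imp_eq_one_iff]
    simp only [truth]
    rw [le_lukImp_iff, lukConj_comm, ← le_lukImp_iff]
    refine iSup_le fun y => ?_
    rw [le_lukImp_iff, lukConj_comm, ← le_lukImp_iff, K.truth_eq_of_modal hν x y]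
    exact iInf_le (fun y => lukImp (K.truth φ y) (K.truth ν y)) y
  | @box_or ν φ hν =>
    rw [truth_imp_eq_one_iff, truth_or]
    simp only [truth]
    by_contra! hlt
    obtain ⟨h1, h2⟩ := sup_lt_iff.1 hlt
    obtain ⟨y, hy⟩ := iInf_lt_iff.1 h1
    have h3 := iInf_le (fun y => K.truth (or φ ν) y) y
    simp only [truth_or] at h3 hy h2
    rw [K.truth_eq_of_modal hν x y] at h2
    refine absurd h3 (not_le.2 (sup_lt_iff.2 ⟨?_, ?_⟩))
    · simpa [truth_or] using hy
    · simpa [truth_or] using h2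
  | dia_conj φ =>
    have hsup (y : K.X) := le_iSup (fun y => K.truth φ y) y
    have hle : K.truth (dia (conj φ φ)) x = K.truth (conj (dia φ) (dia φ)) x := by
      simp only [truth]
      apply le_antisymm
      · refine iSup_le fun y => ?_
        have hy : (K.truth φ y : ℝ) ≤ (⨆ y, K.truth φ y : unitInterval) := hsup y
        rw [← Subtype.coe_le_coe, coe_lukConj, coe_lukConj]
        exact max_le_max le_rfl (by linarith)
      · by_contra! hlt
        set t := ⨆ y, lukConj (K.truth φ y) (K.truth φ y) with ht
        set s := ⨆ y, K.truth φ y with hs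
        have h0 := t.2.1
        have h1 := s.2.2
        have hlt' : (t : ℝ) < max 0 ((s : ℝ) + s - 1) := hlt
        have h2 : (t : ℝ) < (s : ℝ) + s - 1 := (lt_max_iff.1 hlt').resolve_left (not_lt.2 h0)
        -- The solution of `2r - 1 = t`: any value of `φ` above `r` has square above `t`.
        let r : unitInterval := ⟨((t : ℝ) + 1) / 2, by linarith, by linarith⟩
        have hr : r < s := by
          change ((t : ℝ) + 1) / 2 < s
          linarith
        obtain ⟨y, hy⟩ := lt_iSup_iff.1 hr
        have hy' : ((t : ℝ) + 1) / 2 < K.truth φ y := hy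
        have h3 : (lukConj (K.truth φ y) (K.truth φ y) : ℝ) ≤ t :=
          le_iSup (fun y => lukConj (K.truth φ y) (K.truth φ y)) y
        rw [coe_lukConj] at h3
        linarith [le_max_right 0 ((K.truth φ y : ℝ) + K.truth φ y - 1)]
    rw [equiv, truth_and, K.truth_imp_eq_one_iff.2 hle.le, K.truth_imp_eq_one_iff.2 hle.ge,
      inf_idem]

/-- If `β` has value below `1`, its powers reach `0` after finitely many steps, which forces `c =
0`; otherwise multiplying by `β` changes nothing. -/
theorem le_lukConj_of_le_truth_pow {β : Formula} {c : unitInterval} {x : K.X}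
    (h : ∀ n, c ≤ K.truth (pow β n) x) : c ≤ lukConj c (K.truth β x) := by
  have hpow (n : ℕ) : (K.truth (pow β (n + 1)) x : ℝ)
      = max 0 (1 - ((n : ℝ) + 1) * (1 - (K.truth β x : ℝ))) := by
    have h0 := (K.truth β x).2.1
    have h1 := (K.truth β x).2.2
    induction n with
    | zero => simp [pow, h0]
    | succ n ih =>
      rw [pow, truth, coe_lukConj, ih]
      push_cast
      rcases le_total 0 (1 - ((n : ℝ) + 1) * (1 - K.truth β x)) with h | h
      · rw [max_eq_right h]; congr 1; ring
      · rw [max_eq_left h, max_eq_left (by linarith), max_eq_left (by linarith)]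
  rw [← Subtype.coe_le_coe, coe_lukConj]
  rcases (K.truth β x).2.2.eq_or_lt with h1 | h1
  · rw [h1]; exact le_max_of_le_right (by linarith)
  · obtain ⟨n, hn⟩ := exists_nat_gt (1 / (1 - (K.truth β x : ℝ)))
    rw [div_lt_iff₀ (by linarith)] at hn
    have h2 : (c : ℝ) ≤ K.truth (pow β (n + 1)) x := h (n + 1)
    rw [hpow, max_eq_left (by linarith)] at h2
    exact le_max_of_le_left h2

theorem IsModel.truth_eq_one_of_der {K : StdStructure.{u}} {Γ : Set Formula} (hK : K.IsModel Γ)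
    {a : Formula} (h : Der Γ a) (x : K.X) : K.truth a x = 1 := by
  induction h generalizing x with
  | hyp ha => exact hK _ ha x
  | ax ha => exact K.truth_s5Axiom ha x
  | rule hr _ ih =>
    cases hr with
    | mp φ =>
      have h1 := K.truth_imp_eq_one_iff.1 (ih (imp φ _) (Or.inr rfl) x)
      rw [ih φ (Or.inl rfl) x] at h1
      exact le_antisymm unitInterval.le_one' h1
    | nec φ =>
      rw [truth]
      exact le_antisymm unitInterval.le_one' (le_iInf fun y => (ih φ rfl y).ge)
    | boxInf φ α β =>
      rw [truth_or]
      by_cases hφ : K.truth (box φ) x = 1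
      · rw [hφ]; exact sup_eq_left.2 unitInterval.le_one'
      · have h1 (n : ℕ) : K.truth (box α) x ≤ K.truth (pow (box β) n) x := by
          have h2 := ih _ ⟨n, rfl⟩ x
          rw [truth_or] at h2
          rw [← truth_imp_eq_one_iff]
          rcases max_choice (K.truth (box φ) x)
            (K.truth (imp (box α) (pow (box β) n)) x) with h3 | h3
          · exact absurd (h3.symm.trans h2) hφ
          · exact h3.symm.trans h2
        have h2 : K.truth (imp (box α) (conj (box α) (box β))) x = 1 :=
          K.truth_imp_eq_one_iff.2 (K.le_lukConj_of_le_truth_pow h1)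
        rw [h2]
        exact sup_eq_right.2 unitInterval.le_one'

end StdStructure

theorem Provable.entails {Γ : Set Formula} {a : Formula} (h : Provable Γ a) :
    Entails.{u} Γ a := by
  rintro K hK _ rfl x
  exact hK.truth_eq_one_of_der h.der x

end S5Luk

theorem mainTheorem2 (Γ : Set S5Luk.Formula) (φ : S5Luk.Formula) :
    S5Luk.Provable Γ φ ↔ S5Luk.Entails.{u} Γ φ :=
  ⟨S5Luk.Provable.entails, S5Luk.Entails.provable⟩
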